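/- Let $d\ge 0$, let $A,B$ be positive definite complex $d\times d$ matrices, let $X$ be any complex $d\times d$ matrix, and let $|||\cdot|||$ be a unitarily invariant norm on the complex $d\times d$ matrices, that is, a norm with $|||UYV|||=|||Y|||$ for all $Y$ and all unitary $U,V$. For $v\in[0,1]$ put $$f(v)=|||A^{1-v}XB^{v}+A^{v}XB^{1-v}|||,$$ $$r_0(v)=\min\{v,1-v\},\qquad r_n(v)=\min\{2r_{n-1}(v),\,1-2r_{n-1}(v)\}\quad(n\ge 1),$$ $$\Delta_f(n,k)=f\!\left(\tfrac{k-1}{2^n}\right)+f\!\left(\tfrac{k}{2^n}\right)-2f\!\left(\tfrac{2k-1}{2^{n+1}}\right)\quad(n\ge 0,\ 1\le k\le 2^n),$$ and let $\chi_I$ denote the characteristic function of the interval $I$. Then for every $v\in[0,1]$ and every integer $N\ge 0$, $$|||A^{1-v}XB^{v}+A^{v}XB^{1-v}|||\le |||AX+XB|||-\sum_{n=0}^{N-1}r_n(v)\sum_{k=1}^{2^n}\Delta_f(n,k)\,\chi_{\left(\frac{k-1}{2^n},\frac{k}{2^n}\right)}(v),$$ where the sum over $n$ is zero if $N=0$.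 Moreover, for $N=1$ the right-hand side equals $$4r_0(v)\,|||A^{1/2}XB^{1/2}|||+(1-2r_0(v))\,|||AX+XB|||,$$ so that this case is Kittaneh's inequality. -/

import Mathlib

open scoped ComplexOrder MatrixOrder

namespace HeinzRefinement

/-- The functions `r₀(v) = min {v, 1 - v}`, `rₙ₊₁(v) = min {2 rₙ(v), 1 - 2 rₙ(v)}`. -/
noncomputable def r : ℕ → ℝ → ℝ
  | 0, v => min v (1 - v)
  | n + 1, v => min (2 * r n v) (1 - 2 * r n v)

/-- `Δ_f(n, k) = f((k-1)/2ⁿ) + f(k/2ⁿ) - 2 f((2k-1)/2ⁿ⁺¹)`. -/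
noncomputable def Delta (f : ℝ → ℝ) (n k : ℕ) : ℝ :=
  f (((k : ℝ) - 1) / 2 ^ n) + f ((k : ℝ) / 2 ^ n) - 2 * f ((2 * (k : ℝ) - 1) / 2 ^ (n + 1))

/-- The characteristic function of a set of real numbers. -/
noncomputable def chi (I : Set ℝ) (v : ℝ) : ℝ := I.indicator (fun _ => 1) v

/-- The sum of `rₙ(v) ∑_{k=1}^{2ⁿ} Δ_f(n, k) χ_{((k-1)/2ⁿ, k/2ⁿ)}(v)` over `0 ≤ n < N`. -/
noncomputable def refinementSum (f : ℝ → ℝ) (N : ℕ) (v : ℝ) : ℝ :=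
  ∑ n ∈ Finset.range N, r n v *
    ∑ k ∈ Finset.Icc 1 (2 ^ n),
      Delta f n k * chi (Set.Ioo (((k : ℝ) - 1) / 2 ^ n) ((k : ℝ) / 2 ^ n)) v

/-- A seminorm on the complex `d × d` matrices is a unitarily invariant norm if it is definite and
`|||U X V||| = |||X|||` for all matrices `X` and all unitary `U`, `V`. -/
structure IsUnitarilyInvariantNorm {d : ℕ} (p : Seminorm ℂ (Matrix (Fin d) (Fin d) ℂ)) : Prop where
  eq_zero_of_map_eq_zero : ∀ X, p X = 0 → X = 0
  map_unitary_mul_mul : ∀ U ∈ Matrix.unitaryGroup (Fin d) ℂ, ∀ V ∈ Matrix.unitaryGroup (Fin d) ℂ,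
    ∀ X, p (U * X * V) = p X

/-- The function `f(v) = |||A^{1-v} X B^v + A^v X B^{1-v}|||`; the real powers are those of the
continuous functional calculus. -/
noncomputable def heinzNorm {d : ℕ} (p : Seminorm ℂ (Matrix (Fin d) (Fin d) ℂ))
    (A B X : Matrix (Fin d) (Fin d) ℂ) (v : ℝ) : ℝ :=
  p (A ^ (1 - v) * X * B ^ v + A ^ v * X * B ^ (1 - v))

end HeinzRefinement

/-! The function `heinzNorm` is convex on the line, and subtracting the refinement sum from its
chord over `[0, 1]` leaves its piecewise linear interpolant at the dyadic points of level `N`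
(`chord_sub_refinementSum`), which lies above a convex function. The chord is constant because the
values at 0 and 1 agree. For convexity, diagonalize `A` and `B`: averaging over `u - δ` and `u + δ`
becomes Schur multiplication by `cosh (xᵢ - yⱼ)`, so midpoint convexity is `le_map_cosh_mul`. There
`2 cosh t` is the limit of `(1 + t/n)^n + (1 - t/n)^n`, whose roots are purely imaginary. Each
linear factor is bounded below because `i (xᵢ - yⱼ)` generates a group of isometries (`map_phase`).
-/

open Filter Topology Polynomial

namespace HeinzRefinement

/-! ### Dyadic interpolation and convexity -/

section Sums

/-- On a closed dyadic interval of level `n` the inner sum has only one relevant term. -/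
lemma mul_sum_Delta_chi (f : ℝ → ℝ) (n k : ℕ) (hk₁ : 1 ≤ k) (hk : k ≤ 2 ^ n) (v ρ : ℝ)
    (h₁ : (k : ℝ) - 1 ≤ 2 ^ n * v) (h₂ : 2 ^ n * v ≤ k)
    (hρ : ρ = min (2 ^ n * v - (k - 1)) (k - 2 ^ n * v)) :
    ρ * ∑ j ∈ Finset.Icc 1 (2 ^ n),
      Delta f n j * chi (Set.Ioo (((j : ℝ) - 1) / 2 ^ n) ((j : ℝ) / 2 ^ n)) v =
      ρ * Delta f n k := by
  have hpos : (0 : ℝ) < 2 ^ n := by positivity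
  have hmem : ∀ j : ℕ, v ∈ Set.Ioo (((j : ℝ) - 1) / 2 ^ n) ((j : ℝ) / 2 ^ n) ↔
      (j : ℝ) - 1 < 2 ^ n * v ∧ 2 ^ n * v < j := by
    intro j
    rw [Set.mem_Ioo, div_lt_iff₀ hpos, lt_div_iff₀ hpos, mul_comm v]
  rw [Finset.sum_eq_single_of_mem k (Finset.mem_Icc.2 ⟨hk₁, hk⟩)]
  · by_cases hv : v ∈ Set.Ioo (((k : ℝ) - 1) / 2 ^ n) ((k : ℝ) / 2 ^ n)
    · simp [chi, hv]
    -- At an endpoint of the closed interval the open indicator vanishes, but so does `ρ`.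
    · have : ρ = 0 := by
        rw [hmem, not_and_or, not_lt, not_lt] at hv
        rw [hρ]
        rcases hv with hv | hv
        · rw [min_eq_left] <;> linarith
        · rw [min_eq_right] <;> linarith
      simp [this]
  · intro j _ hjk
    have hv : v ∉ Set.Ioo (((j : ℝ) - 1) / 2 ^ n) ((j : ℝ) / 2 ^ n) := by
      rw [hmem]
      rintro ⟨h₃, h₄⟩
      have h₅ : (j : ℝ) < k + 1 := by linarith
      have h₆ : (k : ℝ) < j + 1 := by linarith
      have h₇ : j < k + 1 := by exact_mod_cast h₅
      have h₈ : k < j + 1 := by exact_mod_cast h₆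
      omega
    simp [chi, hv]

/-- Subtracting the refinement sum from the chord of `f` over `[0, 1]` gives the piecewise linear
interpolation of `f` at the dyadic points of level `N`. -/
lemma chord_sub_refinementSum (f : ℝ → ℝ) (v : ℝ) (N : ℕ) : ∀ k : ℕ, 1 ≤ k → k ≤ 2 ^ N →
    (k : ℝ) - 1 ≤ 2 ^ N * v → 2 ^ N * v ≤ k →
    r N v = min (2 ^ N * v - (k - 1)) (k - 2 ^ N * v) ∧
    (1 - v) * f 0 + v * f 1 - refinementSum f N v =
      (k - 2 ^ N * v) * f (((k : ℝ) - 1) / 2 ^ N) +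
        (2 ^ N * v - (k - 1)) * f ((k : ℝ) / 2 ^ N) := by
  induction N with
  | zero =>
    intro k hk₁ hk h₁ h₂
    obtain rfl : k = 1 := by simp at hk; omega
    simp [r, refinementSum]
  | succ N ih =>
    intro k hk₁ hk h₁ h₂
    have hsum : refinementSum f (N + 1) v = refinementSum f N v + r N v *
        ∑ j ∈ Finset.Icc 1 (2 ^ N),
          Delta f N j * chi (Set.Ioo (((j : ℝ) - 1) / 2 ^ N) ((j : ℝ) / 2 ^ N)) v :=
      Finset.sum_range_succ _ _
    have hpow : (2 : ℝ) ^ (N + 1) * v = 2 * (2 ^ N * v) := by ring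
    rw [hpow] at h₁ h₂ ⊢
    have hpowk : k ≤ 2 * 2 ^ N := by rw [pow_succ] at hk; omega
    -- Even `k` is the right half of a level-`N` interval, odd `k` the left half; on each half `r N
    -- v` is linear.
    rcases Nat.even_or_odd' k with ⟨m, rfl | rfl⟩
    · push_cast at h₁ h₂ ⊢
      obtain ⟨hr, hI⟩ := ih m (by omega) (by omega) (by linarith) (by linarith)
      have hS := mul_sum_Delta_chi f N m (by omega) (by omega) v (r N v) (by linarith)
        (by linarith) hr
      have hr' : r N v = m - 2 ^ N * v := by rw [hr, min_eq_right]; linarith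
      refine ⟨?_, ?_⟩
      · rw [r, hr', min_comm]
        congr 1 <;> ring
      · have e₁ : (2 * (m : ℝ)) / 2 ^ (N + 1) = m / 2 ^ N := by
          rw [pow_succ]; field_simp
        rw [hsum, hS, ← sub_sub, hI, hr', Delta, e₁]
        ring
    · push_cast at h₁ h₂ ⊢
      obtain ⟨hr, hI⟩ := ih (m + 1) (by omega) (by omega) (by push_cast; linarith)
        (by push_cast; linarith)
      have hS := mul_sum_Delta_chi f N (m + 1) (by omega) (by omega) v (r N v)
        (by push_cast; linarith) (by push_cast; linarith) hr
      push_cast at hr hI hS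
      have hr' : r N v = 2 ^ N * v - m := by rw [hr, min_eq_left] <;> linarith
      refine ⟨?_, ?_⟩
      · rw [r, hr']
        congr 1 <;> ring
      · have e₁ : (2 * (m : ℝ) + 1 - 1) / 2 ^ (N + 1) = m / 2 ^ N := by
          rw [pow_succ]; field_simp; ring
        have e₂ : (2 * ((m : ℝ) + 1) - 1) / 2 ^ (N + 1) = (2 * m + 1) / 2 ^ (N + 1) := by
          ring
        rw [hsum, hS, ← sub_sub, hI, hr', Delta, e₁]
        push_cast
        rw [e₂, add_sub_cancel_right]
        ring

/-- A dyadic interval of level `N` containing a given point of `[0, 1]`. -/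
lemma exists_dyadic (N : ℕ) {v : ℝ} (hv₀ : 0 ≤ v) (hv₁ : v ≤ 1) :
    ∃ k : ℕ, 1 ≤ k ∧ k ≤ 2 ^ N ∧ (k : ℝ) - 1 ≤ 2 ^ N * v ∧ 2 ^ N * v ≤ k := by
  have hpos : (0 : ℝ) < 2 ^ N := by positivity
  -- The ceiling of 0 is 0, which is not an admissible index, so `v = 0` is separate.
  rcases hv₀.eq_or_lt with rfl | hv
  · exact ⟨1, le_rfl, Nat.one_le_two_pow, by simp, by simp⟩
  · refine ⟨⌈2 ^ N * v⌉₊, Nat.one_le_ceil_iff.2 (by positivity), ?_, ?_, Nat.le_ceil _⟩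
    · rw [Nat.ceil_le]
      push_cast
      nlinarith
    · linarith [Nat.ceil_lt_add_one (show 0 ≤ 2 ^ N * v by positivity)]

/-- A continuous midpoint convex function lies below its chords. -/
lemma le_chord_of_midpoint {f : ℝ → ℝ} (hf : Continuous f)
    (hmid : ∀ u δ, 2 * f u ≤ f (u - δ) + f (u + δ)) (a b t : ℝ) (ht₀ : 0 ≤ t) (ht₁ : t ≤ 1) :
    f ((1 - t) * a + t * b) ≤ (1 - t) * f a + t * f b := by
  set h : ℝ → ℝ := fun t => f ((1 - t) * a + t * b) - ((1 - t) * f a + t * f b) with hh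
  have hcont : ContinuousOn h (Set.Icc 0 1) := by
    apply Continuous.continuousOn
    fun_prop
  have h0 : h 0 = 0 := by simp [hh]
  have h1 : h 1 = 0 := by simp [hh]
  obtain ⟨s, hs, hmax⟩ := isCompact_Icc.exists_isMaxOn
    (Set.nonempty_Icc.2 (zero_le_one' ℝ)) hcont
  have hle : ∀ y ∈ Set.Icc (0 : ℝ) 1, h y ≤ h s := fun y hy => hmax hy
  have hm : ∀ δ, 2 * h s ≤ h (s - δ) + h (s + δ) := by
    intro δ
    have := hmid ((1 - s) * a + s * b) (δ * (b - a))
    have e₁ : (1 - s) * a + s * b - δ * (b - a) = (1 - (s - δ)) * a + (s - δ) * b := by ring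
    have e₂ : (1 - s) * a + s * b + δ * (b - a) = (1 - (s + δ)) * a + (s + δ) * b := by ring
    rw [e₁, e₂] at this
    simp only [hh]
    linarith
  -- Reflect the nearer endpoint, where `h` is 0, in the maximum point `s`: then `2 h s ≤ 0 + h s`.
  have hs0 : h s ≤ 0 := by
    rcases le_total s (1 / 2) with h' | h'
    · have h₂ := hm s
      rw [sub_self, h0] at h₂
      linarith [hle (s + s) ⟨by linarith [hs.1], by linarith⟩]
    · have h₂ := hm (1 - s)
      rw [show s + (1 - s) = 1 by ring, h1] at h₂
      linarith [hle (s - (1 - s)) ⟨by linarith, by linarith [hs.2]⟩]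
  have := (hle t ⟨ht₀, ht₁⟩).trans hs0
  simp only [hh] at this
  linarith

/-- Dyadic refinement of the chord inequality for continuous midpoint convex functions. -/
lemma le_chord_sub_refinementSum {f : ℝ → ℝ} (hf : Continuous f)
    (hmid : ∀ u δ, 2 * f u ≤ f (u - δ) + f (u + δ)) {v : ℝ} (hv₀ : 0 ≤ v) (hv₁ : v ≤ 1)
    (N : ℕ) : f v ≤ (1 - v) * f 0 + v * f 1 - refinementSum f N v := by
  obtain ⟨k, hk₁, hk, h₁, h₂⟩ := exists_dyadic N hv₀ hv₁
  rw [(chord_sub_refinementSum f v N k hk₁ hk h₁ h₂).2]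
  have := le_chord_of_midpoint hf hmid (((k : ℝ) - 1) / 2 ^ N) ((k : ℝ) / 2 ^ N)
    (2 ^ N * v - (k - 1)) (by linarith) (by linarith)
  have e₁ : (1 - (2 ^ N * v - ((k : ℝ) - 1))) * (((k : ℝ) - 1) / 2 ^ N) +
      (2 ^ N * v - (k - 1)) * ((k : ℝ) / 2 ^ N) = v := by
    field_simp
    ring
  rw [e₁] at this
  linarith

end Sums

/-! ### Schur multipliers and unitarily invariant norms -/

section Norms

variable {d : ℕ} {p : Seminorm ℂ (Matrix (Fin d) (Fin d) ℂ)}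

/-- Every seminorm on a space of matrices is continuous. -/
lemma continuous_seminorm (p : Seminorm ℂ (Matrix (Fin d) (Fin d) ℂ)) : Continuous p := by
  refine Seminorm.continuous_of_continuousAt_zero (p := p) ?_
  have hbound : ∀ M, p M ≤ ∑ i, ∑ j, ‖M i j‖ * p (Matrix.single i j 1) := by
    intro M
    conv_lhs => rw [Matrix.matrix_eq_sum_single M]
    refine (Finset.le_sum_of_subadditive p (map_zero p).le (map_add_le_add p) _ _).trans
      (Finset.sum_le_sum fun i _ => ?_)
    refine (Finset.le_sum_of_subadditive p (map_zero p).le (map_add_le_add p) _ _).trans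
      (Finset.sum_le_sum fun j _ => ?_)
    rw [← map_smul_eq_mul p, Matrix.smul_single, smul_eq_mul, mul_one]
  rw [ContinuousAt, map_zero]
  refine squeeze_zero (fun M => apply_nonneg p M) hbound ?_
  have hc : Continuous fun M : Matrix (Fin d) (Fin d) ℂ =>
      ∑ i, ∑ j, ‖M i j‖ * p (Matrix.single i j 1) := by
    fun_prop
  simpa using hc.tendsto 0

lemma diagonal_mem_unitaryGroup {z : Fin d → ℂ} (hz : ∀ i, ‖z i‖ = 1) :
    Matrix.diagonal z ∈ Matrix.unitaryGroup (Fin d) ℂ := by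
  rw [Matrix.mem_unitaryGroup_iff, Matrix.star_eq_conjTranspose, Matrix.diagonal_conjTranspose,
    Matrix.diagonal_mul_diagonal, ← Matrix.diagonal_one]
  congr 1
  ext i
  simp [Complex.mul_conj, Complex.normSq_eq_norm_sq, hz]

/-- Multiplying the entries by `exp (i h (xᵢ - yⱼ))` does not change the norm. -/
lemma map_phase (hp : IsUnitarilyInvariantNorm p) (x y : Fin d → ℝ) (h : ℝ)
    (T : Matrix (Fin d) (Fin d) ℂ) :
    p (Matrix.of fun i j => Complex.exp (h * (Complex.I * (x i - y j))) * T i j) = p T := by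
  have hU : Matrix.diagonal (fun i => Complex.exp (((h * x i : ℝ) : ℂ) * Complex.I)) ∈
      Matrix.unitaryGroup (Fin d) ℂ :=
    diagonal_mem_unitaryGroup fun i => Complex.norm_exp_ofReal_mul_I _
  have hV : Matrix.diagonal (fun j => Complex.exp (((-(h * y j) : ℝ) : ℂ) * Complex.I)) ∈
      Matrix.unitaryGroup (Fin d) ℂ :=
    diagonal_mem_unitaryGroup fun i => Complex.norm_exp_ofReal_mul_I _
  rw [← hp.map_unitary_mul_mul _ hU _ hV T]
  congr 1
  ext i j
  rw [Matrix.mul_diagonal, Matrix.diagonal_mul, Matrix.of_apply, mul_right_comm, ← Complex.exp_add]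
  congr 2
  push_cast
  ring

/-- A resolvent bound for the generator of the isometry group of `map_phase`: replace the generator
by a difference quotient, use the triangle inequality, and let the step tend to 0. -/
lemma le_map_mul_add_of_nonneg (hp : IsUnitarilyInvariantNorm p) (x y : Fin d → ℝ) (s : ℝ)
    (hs : 0 ≤ s) (T : Matrix (Fin d) (Fin d) ℂ) :
    s * p T ≤ p (Matrix.of fun i j => (s + Complex.I * (x i - y j)) * T i j) := by
  set G : ℝ → Matrix (Fin d) (Fin d) ℂ := fun h => Matrix.of fun i j =>
    (s + h⁻¹ • (Complex.exp (((0 + h : ℝ) : ℂ) * (Complex.I * (x i - y j))) -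
      Complex.exp (((0 : ℝ) : ℂ) * (Complex.I * (x i - y j))))) * T i j with hG
  -- Negative steps make `-h⁻¹` and `s - h⁻¹` nonnegative, so the `-h⁻¹ * p T` terms cancel.
  have hlim : Tendsto G (𝓝[<] 0)
      (𝓝 (Matrix.of fun i j => (s + Complex.I * (x i - y j)) * T i j)) := by
    refine tendsto_pi_nhds.2 fun i => tendsto_pi_nhds.2 fun j => ?_
    refine Tendsto.mul_const _ (tendsto_const_nhds.add ?_)
    have hd : HasDerivAt (fun t : ℝ => Complex.exp ((t : ℂ) * (Complex.I * (x i - y j))))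
        (Complex.I * (x i - y j)) 0 := by
      have := ((Complex.ofRealCLM.hasDerivAt (x := (0 : ℝ))).mul_const
        (Complex.I * ((x i : ℂ) - y j))).cexp
      simpa using this
    exact (hasDerivAt_iff_tendsto_slope_zero.1 hd).mono_left
      (nhdsWithin_mono _ fun t ht => ne_of_lt ht)
  refine ge_of_tendsto (((continuous_seminorm p).tendsto _).comp hlim) ?_
  filter_upwards [self_mem_nhdsWithin] with h hh
  have hh : h < 0 := hh
  have hinv : h⁻¹ < 0 := inv_lt_zero.2 hh
  have hdecomp : ((s - h⁻¹ : ℝ) : ℂ) • T = G h + ((-h⁻¹ : ℝ) : ℂ) •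
      (Matrix.of fun i j => Complex.exp (h * (Complex.I * (x i - y j))) * T i j) := by
    ext i j
    simp only [hG, Matrix.add_apply, Matrix.smul_apply, Matrix.of_apply, Complex.real_smul,
      smul_eq_mul]
    push_cast
    simp
    ring
  have := map_add_le_add p (G h) (((-h⁻¹ : ℝ) : ℂ) •
      (Matrix.of fun i j => Complex.exp (h * (Complex.I * (x i - y j))) * T i j))
  rw [← hdecomp, map_smul_eq_mul, map_smul_eq_mul, map_phase hp, Complex.norm_real,
    Complex.norm_real, Real.norm_of_nonneg (by linarith), Real.norm_of_nonneg (by linarith)] at this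
  simp only [Function.comp_apply]
  linarith

/-- The Schur multiplier `xᵢ - yⱼ - z` with `z` purely imaginary is bounded below by `‖z‖`. -/
lemma le_map_sub_mul (hp : IsUnitarilyInvariantNorm p) (x y : Fin d → ℝ) (z : ℂ)
    (hz : z.re = 0) (T : Matrix (Fin d) (Fin d) ℂ) :
    ‖z‖ * p T ≤ p (Matrix.of fun i j => ((x i - y j : ℂ) - z) * T i j) := by
  obtain ⟨s, rfl⟩ : ∃ s : ℝ, z = s * Complex.I := ⟨z.im, by apply Complex.ext <;> simp [hz]⟩
  have hnorm : ‖(s : ℂ) * Complex.I‖ = |s| := by simp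
  rw [hnorm]
  rcases le_total 0 s with hs | hs
  · have := le_map_mul_add_of_nonneg hp x y s hs T
    rw [abs_of_nonneg hs]
    refine this.trans_eq ?_
    have e : (Matrix.of fun i j => (s + Complex.I * (x i - y j)) * T i j) =
        Complex.I • Matrix.of fun i j => ((x i - y j : ℂ) - s * Complex.I) * T i j := by
      ext i j
      simp only [Matrix.smul_apply, Matrix.of_apply, smul_eq_mul]
      linear_combination (s * T i j) * Complex.I_mul_I
    rw [e, map_smul_eq_mul, Complex.norm_I, one_mul]
  -- Negating `x`, `y` and `s` reduces to the previous sign.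
  · have := le_map_mul_add_of_nonneg hp (-x) (-y) (-s) (by linarith) T
    rw [abs_of_nonpos hs]
    refine this.trans_eq ?_
    have e : (Matrix.of fun i j => (((-s : ℝ) : ℂ) +
        Complex.I * (((-x) i : ℝ) - ((-y) j : ℝ))) * T i j) =
        (-Complex.I) • Matrix.of fun i j => ((x i - y j : ℂ) - s * Complex.I) * T i j := by
      ext i j
      simp only [Matrix.smul_apply, Matrix.of_apply, smul_eq_mul, Pi.neg_apply]
      push_cast
      linear_combination (-s * T i j) * Complex.I_mul_I
    rw [e, map_smul_eq_mul, norm_neg, Complex.norm_I, one_mul]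

/-- Schur multipliers compose, so the bound for one factor is applied to the matrix already
multiplied by the others. -/
lemma le_map_prod_sub_mul (hp : IsUnitarilyInvariantNorm p) (x y : Fin d → ℝ) (m : Multiset ℂ)
    (hm : ∀ z ∈ m, z.re = 0) (T : Matrix (Fin d) (Fin d) ℂ) :
    ‖(m.map fun z => 0 - z).prod‖ * p T ≤
      p (Matrix.of fun i j => (m.map fun z => (x i - y j : ℂ) - z).prod * T i j) := by
  induction m using Multiset.induction_on with
  | empty => simp [show (Matrix.of fun i j => T i j) = T from rfl]
  | cons z m ih =>
    have h₁ := ih fun w hw => hm w (Multiset.mem_cons_of_mem hw)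
    have h₂ := le_map_sub_mul hp x y z (hm z (Multiset.mem_cons_self z m))
      (Matrix.of fun i j => (m.map fun z => (x i - y j : ℂ) - z).prod * T i j)
    simp only [Multiset.map_cons, Multiset.prod_cons, Matrix.of_apply, ← mul_assoc] at h₂ ⊢
    rw [norm_mul, zero_sub, norm_neg, mul_assoc]
    exact (mul_le_mul_of_nonneg_left h₁ (norm_nonneg z)).trans h₂

/-- A polynomial Schur multiplier in `xᵢ - yⱼ` with purely imaginary roots. -/
lemma le_map_eval_mul (hp : IsUnitarilyInvariantNorm p) (x y : Fin d → ℝ) (P : ℂ[X])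
    (hP : ∀ z ∈ P.roots, z.re = 0) (T : Matrix (Fin d) (Fin d) ℂ) :
    ‖P.eval 0‖ * p T ≤ p (Matrix.of fun i j => P.eval (x i - y j : ℂ) * T i j) := by
  have hs : P.Splits := IsAlgClosed.splits P
  have e : (Matrix.of fun i j => P.eval (x i - y j : ℂ) * T i j) = P.leadingCoeff •
      Matrix.of fun i j => (P.roots.map fun z => (x i - y j : ℂ) - z).prod * T i j := by
    ext i j
    simp [hs.eval_eq_prod_roots, mul_assoc]
  rw [e, map_smul_eq_mul, hs.eval_eq_prod_roots, norm_mul, mul_assoc]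
  exact mul_le_mul_of_nonneg_left (le_map_prod_sub_mul hp x y P.roots hP T) (norm_nonneg _)

/-- If `‖1 + c z‖ = ‖1 - c z‖` with `c ≠ 0` real, then `z` is purely imaginary. -/
lemma re_eq_zero_of_norm_eq {c : ℝ} (hc : c ≠ 0) {z : ℂ} (h : ‖1 + c * z‖ = ‖1 - c * z‖) :
    z.re = 0 := by
  have h₂ : Complex.normSq (1 + c * z) = Complex.normSq (1 - c * z) := by
    rw [Complex.normSq_eq_norm_sq, Complex.normSq_eq_norm_sq, h]
  simp only [Complex.normSq_apply, Complex.add_re, Complex.sub_re, Complex.add_im, Complex.sub_im,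
    Complex.one_re, Complex.one_im, Complex.mul_re, Complex.mul_im, Complex.ofReal_re,
    Complex.ofReal_im] at h₂
  have : c * z.re = 0 := by linarith
  exact (mul_eq_zero.1 this).resolve_left hc

/-- The matrix arithmetic-geometric mean inequality for unitarily invariant norms, in diagonal
form. -/
lemma le_map_cosh_mul (hp : IsUnitarilyInvariantNorm p) (x y : Fin d → ℝ)
    (T : Matrix (Fin d) (Fin d) ℂ) :
    2 * p T ≤ p (Matrix.of fun i j =>
      (Complex.exp (x i - y j) + Complex.exp (-(x i - y j))) * T i j) := by
  have hlim : Tendsto (fun n : ℕ => Matrix.of fun i j =>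
      ((1 + (x i - y j : ℂ) / n) ^ n + (1 + (-(x i - y j) : ℂ) / n) ^ n) * T i j) atTop
      (𝓝 (Matrix.of fun i j =>
        (Complex.exp (x i - y j) + Complex.exp (-(x i - y j))) * T i j)) := by
    refine tendsto_pi_nhds.2 fun i => tendsto_pi_nhds.2 fun j => ?_
    exact ((Complex.tendsto_one_add_div_pow_exp _).add
      (Complex.tendsto_one_add_div_pow_exp _)).mul_const _
  refine ge_of_tendsto (((continuous_seminorm p).tendsto _).comp hlim) ?_
  filter_upwards [eventually_ge_atTop 1] with n hn
  have hn0 : (n : ℝ) ≠ 0 := by positivity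
  set P : ℂ[X] := (1 + C (((n : ℝ)⁻¹ : ℝ) : ℂ) * X) ^ n + (1 - C (((n : ℝ)⁻¹ : ℝ) : ℂ) * X) ^ n
  have heval : ∀ z, P.eval z =
      (1 + ((n : ℝ)⁻¹ : ℝ) * z) ^ n + (1 - ((n : ℝ)⁻¹ : ℝ) * z) ^ n := by
    intro z
    simp [P]
  -- At a root the two `n`-th powers have equal modulus, hence so do their bases.
  have hroots : ∀ z ∈ P.roots, z.re = 0 := by
    intro z hz
    have h := (mem_roots'.1 hz).2
    rw [IsRoot.def, heval, add_eq_zero_iff_eq_neg] at h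
    refine re_eq_zero_of_norm_eq (inv_ne_zero hn0) ?_
    have h' := congrArg norm h
    rw [norm_neg, norm_pow, norm_pow] at h'
    exact (pow_left_inj₀ (norm_nonneg _) (norm_nonneg _) (by omega)).1 h'
  have := le_map_eval_mul hp x y P hroots T
  have h0 : ‖P.eval 0‖ = 2 := by
    rw [heval]
    norm_num
  rw [h0] at this
  refine this.trans_eq (congrArg p ?_)
  ext i j
  simp only [Matrix.of_apply, heval]
  push_cast
  congr 3 <;> ring

/-- Real powers of a positive definite matrix, simultaneously diagonalized. -/
lemma exists_rpow_eq {A : Matrix (Fin d) (Fin d) ℂ} (hA : A.PosDef) :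
    ∃ U ∈ Matrix.unitaryGroup (Fin d) ℂ, ∃ a : Fin d → ℝ, ∀ v : ℝ,
      A ^ v = U * Matrix.diagonal (fun i => Complex.exp (v * a i)) * star U := by
  refine ⟨hA.isHermitian.eigenvectorUnitary, SetLike.coe_mem _,
    fun i => Real.log (hA.isHermitian.eigenvalues i), fun v => ?_⟩
  have hA0 : 0 ≤ A := Matrix.nonneg_iff_posSemidef.2 hA.posSemidef
  rw [CFC.rpow_def, cfc_nnreal_eq_real _ A hA0, hA.isHermitian.cfc_eq, Matrix.IsHermitian.cfc,
    Unitary.conjStarAlgAut_apply]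
  congr 3
  ext i
  have hi := hA.eigenvalues_pos i
  simp only [Function.comp_apply, NNReal.coe_rpow, Real.coe_toNNReal', max_eq_left hi.le]
  rw [Real.rpow_def_of_pos hi, mul_comm]
  simp

/-- The Heinz norm is the norm of a Schur product with exponentials. -/
lemma exists_heinzNorm_eq (hp : IsUnitarilyInvariantNorm p) {A B : Matrix (Fin d) (Fin d) ℂ}
    (X : Matrix (Fin d) (Fin d) ℂ) (hA : A.PosDef) (hB : B.PosDef) :
    ∃ (a b : Fin d → ℝ) (Y : Matrix (Fin d) (Fin d) ℂ), ∀ v : ℝ, heinzNorm p A B X v =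
      p (Matrix.of fun i j => (Complex.exp ((1 - v) * a i + v * b j) +
        Complex.exp (v * a i + (1 - v) * b j)) * Y i j) := by
  obtain ⟨U, hU, a, ha⟩ := exists_rpow_eq hA
  obtain ⟨W, hW, b, hb⟩ := exists_rpow_eq hB
  refine ⟨a, b, star U * X * W, fun v => ?_⟩
  rw [← hp.map_unitary_mul_mul U hU (star W) (Unitary.star_mem hW), heinzNorm, ha, ha, hb, hb]
  congr 1
  have e : (Matrix.of fun i j => (Complex.exp ((1 - v) * a i + v * b j) +
        Complex.exp (v * a i + (1 - v) * b j)) * (star U * X * W) i j) =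
      Matrix.diagonal (fun i => Complex.exp (((1 - v : ℝ) : ℂ) * a i)) * (star U * X * W) *
        Matrix.diagonal (fun j => Complex.exp (v * b j)) +
      Matrix.diagonal (fun i => Complex.exp (v * a i)) * (star U * X * W) *
        Matrix.diagonal (fun j => Complex.exp (((1 - v : ℝ) : ℂ) * b j)) := by
    ext i j
    simp only [Matrix.add_apply, Matrix.mul_diagonal, Matrix.diagonal_mul, Matrix.of_apply,
      Complex.exp_add]
    push_cast
    ring
  rw [e]
  simp only [Matrix.mul_add, Matrix.add_mul, Matrix.mul_assoc]

lemma continuous_heinzNorm (hp : IsUnitarilyInvariantNorm p) {A B : Matrix (Fin d) (Fin d) ℂ}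
    (X : Matrix (Fin d) (Fin d) ℂ) (hA : A.PosDef) (hB : B.PosDef) :
    Continuous (heinzNorm p A B X) := by
  obtain ⟨a, b, Y, h⟩ := exists_heinzNorm_eq hp X hA hB
  rw [funext h]
  refine (continuous_seminorm p).comp ?_
  refine continuous_pi fun i => continuous_pi fun j => ?_
  simp only [Matrix.of_apply]
  fun_prop

/-- Adding the Schur multipliers at `u - δ` and `u + δ` factors as the one at `u` times `2 cosh (δ
(aᵢ - bⱼ))`. -/
lemma heinzNorm_midpoint (hp : IsUnitarilyInvariantNorm p) {A B : Matrix (Fin d) (Fin d) ℂ}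
    (X : Matrix (Fin d) (Fin d) ℂ) (hA : A.PosDef) (hB : B.PosDef) (u δ : ℝ) :
    2 * heinzNorm p A B X u ≤ heinzNorm p A B X (u - δ) + heinzNorm p A B X (u + δ) := by
  obtain ⟨a, b, Y, h⟩ := exists_heinzNorm_eq hp X hA hB
  rw [h, h, h]
  refine (le_map_cosh_mul hp (fun i => δ * a i) (fun j => δ * b j) _).trans ?_
  refine le_trans (le_of_eq (congrArg p ?_)) (map_add_le_add p _ _)
  ext i j
  simp only [Matrix.add_apply, Matrix.of_apply]
  rw [← mul_assoc, ← add_mul, add_mul (Complex.exp _), mul_add, mul_add]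
  simp only [← Complex.exp_add]
  push_cast
  ring_nf

end Norms

end HeinzRefinement

theorem mainTheorem10 {d : ℕ} (p : Seminorm ℂ (Matrix (Fin d) (Fin d) ℂ))
    (hp : HeinzRefinement.IsUnitarilyInvariantNorm p)
    (A B X : Matrix (Fin d) (Fin d) ℂ) (hA : A.PosDef) (hB : B.PosDef)
    (v : ℝ) (hv₀ : 0 ≤ v) (hv₁ : v ≤ 1) :
    (∀ N : ℕ, p (A ^ (1 - v) * X * B ^ v + A ^ v * X * B ^ (1 - v)) ≤
      p (A * X + X * B) -
        HeinzRefinement.refinementSum (HeinzRefinement.heinzNorm p A B X) N v) ∧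
    p (A * X + X * B) - HeinzRefinement.refinementSum (HeinzRefinement.heinzNorm p A B X) 1 v =
      4 * min v (1 - v) * p (A ^ (1 / 2 : ℝ) * X * B ^ (1 / 2 : ℝ)) +
        (1 - 2 * min v (1 - v)) * p (A * X + X * B) := by
  have hA0 : 0 ≤ A := Matrix.nonneg_iff_posSemidef.2 hA.posSemidef
  have hB0 : 0 ≤ B := Matrix.nonneg_iff_posSemidef.2 hB.posSemidef
  have h0 : HeinzRefinement.heinzNorm p A B X 0 = p (A * X + X * B) := by
    simp [HeinzRefinement.heinzNorm, CFC.rpow_one A hA0, CFC.rpow_one B hB0,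
      CFC.rpow_zero A hA0, CFC.rpow_zero B hB0]
  have h1 : HeinzRefinement.heinzNorm p A B X 1 = p (A * X + X * B) := by
    simp [HeinzRefinement.heinzNorm, CFC.rpow_one A hA0, CFC.rpow_one B hB0,
      CFC.rpow_zero A hA0, CFC.rpow_zero B hB0, add_comm]
  have hhalf : HeinzRefinement.heinzNorm p A B X (1 / 2) =
      2 * p (A ^ (1 / 2 : ℝ) * X * B ^ (1 / 2 : ℝ)) := by
    rw [HeinzRefinement.heinzNorm, show (1 : ℝ) - 1 / 2 = 1 / 2 by norm_num, ← two_smul ℂ,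
      map_smul_eq_mul]
    norm_num
  refine ⟨fun N => ?_, ?_⟩
  · have := HeinzRefinement.le_chord_sub_refinementSum
      (HeinzRefinement.continuous_heinzNorm hp X hA hB)
      (HeinzRefinement.heinzNorm_midpoint hp X hA hB) hv₀ hv₁ N
    rw [h0, h1] at this
    exact this.trans_eq (by ring)
  · have hS := HeinzRefinement.mul_sum_Delta_chi (HeinzRefinement.heinzNorm p A B X) 0 1 le_rfl
      (by simp) v (min v (1 - v)) (by simpa using hv₀) (by simpa using hv₁) (by simp)
    have hsum : HeinzRefinement.refinementSum (HeinzRefinement.heinzNorm p A B X) 1 v =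
        min v (1 - v) * HeinzRefinement.Delta (HeinzRefinement.heinzNorm p A B X) 0 1 := by
      rw [HeinzRefinement.refinementSum, Finset.sum_range_one]
      exact hS
    have hD : HeinzRefinement.Delta (HeinzRefinement.heinzNorm p A B X) 0 1 =
        2 * p (A * X + X * B) - 4 * p (A ^ (1 / 2 : ℝ) * X * B ^ (1 / 2 : ℝ)) := by
      have e : HeinzRefinement.Delta (HeinzRefinement.heinzNorm p A B X) 0 1 =
          HeinzRefinement.heinzNorm p A B X 0 + HeinzRefinement.heinzNorm p A B X 1 -
            2 * HeinzRefinement.heinzNorm p A B X (1 / 2) := by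
        rw [HeinzRefinement.Delta]
        norm_num
      rw [e, h0, h1, hhalf]
      ring
    rw [hsum, hD]
    ring
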